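/- Let $X$ be a real Banach space and $\mathcal K\subset X$ compact. For an integer $n\ge 1$ and a real number $N\ge 1$, the nonlinear Kolmogorov width is $$d_n(\mathcal K,N)_X:=\inf_{\mathcal L_N}\ \sup_{f\in\mathcal K}\ \inf_{X_n\in\mathcal L_N}\mathrm{dist}(f,X_n)_X,$$ where the outer infimum is over all sets $\mathcal L_N$ of at most $N$ linear subspaces $X_n\subset X$ of dimension $n$ (and $\inf\emptyset=\infty$). For $n\ge 1$ and $\gamma\ge 0$, the Lipschitz width is $$d_n^{\gamma}(\mathcal K)_X:=\inf_{1\le k\le n}\ \inf_{\|\cdot\|_{Y_k}}\ \inf_{\Phi}\ \sup_{f\in\mathcal K}\ \inf_{y\in B_{Y_k}}\|f-\Phi(y)\|_X,$$ where $\|\cdot\|_{Y_k}$ runs over all norms on $\mathbb R^k$, $B_{Y_k}:=\{y\in\mathbb R^k:\|y\|_{Y_k}\le 1\}$, and $\Phi$ runs over all maps $B_{Y_k}\to X$ with $\|\Phi(y)-\Phi(y')\|_X\le\gamma\|y-y'\|_{Y_k}$ for all $y,y'\in B_{Y_k}$. **Lemma.** For every integer $n\ge 1$, every real $N>1$, and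 every compact subset $\mathcal K$ of a real Banach space $X$ with $\sup_{f\in\mathcal K}\|f\|_X=1$, we have $$d^{\,2(N+1)\sqrt n}_{n+1}(\mathcal K)_X\le d_n(\mathcal K,N)_X\quad\text{and}\quad d^{\,6\sqrt n}_{n+\lceil\log_2N\rceil}(\mathcal K)_X\le d_n(\mathcal K,N)_X.$$ When $X=L_p(\Omega,\mu)$ is the real $L_p$-space of an arbitrary measure space, $1\le p\le\infty$, we have moreover $$d^{\,2(N+1)n^{|1/2-1/p|}}_{n+1}(\mathcal K)_{L_p}\le d_n(\mathcal K,N)_{L_p}\quad\text{and}\quad d^{\,6n^{|1/2-1/p|}}_{n+\lceil\log_2N\rceil}(\mathcal K)_{L_p}\le d_n(\mathcal K,N)_{L_p},$$ with $1/p=0$ for $p=\infty$. -/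

import Mathlib

open scoped ENNReal

universe u v

/-- The nonlinear Kolmogorov `(n, N)`-width `d_n(K, N)_X` of a set `K` in a real normed space `X`,
with values in `[0, ∞]`. For `n = 0` it is `sup_{f ∈ K} ‖f‖`. For `n ≥ 1` it is the infimum, over
all sets `L` of at most `N` linear subspaces of `X` of dimension (exactly) `n`, of
`sup_{f ∈ K} inf_{V ∈ L} dist(f, V)`. The bound `N` is a real number, so that values such as
`N = λ ^ n` with `λ > 1` are allowed; an infimum over the empty set is `∞`. -/
noncomputable def nonlinearKolmogorovWidth {X : Type u} [NormedAddCommGroup X] [NormedSpace ℝ X]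
    (K : Set X) (n : ℕ) (N : ℝ) : ℝ≥0∞ :=
  if n = 0 then ⨆ f ∈ K, ‖f‖ₑ
  else
    ⨅ (L : Finset (Submodule ℝ X)) (_ : (L.card : ℝ) ≤ N)
      (_ : ∀ V ∈ L, Module.rank ℝ V = (n : Cardinal)),
      ⨆ f ∈ K, ⨅ V ∈ L, Metric.infEDist f (V : Set X)

/-- A norm on `ℝ^k`: a definite seminorm. -/
def IsNormOn {k : ℕ} (ν : Seminorm ℝ (Fin k → ℝ)) : Prop :=
  ∀ y, ν y = 0 → y = 0

/-- The closed unit ball of `ℝ^k` with respect to `ν`. -/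
def unitBall {k : ℕ} (ν : Seminorm ℝ (Fin k → ℝ)) : Set (Fin k → ℝ) :=
  {y | ν y ≤ 1}

/-- `Φ` is Lipschitz with constant `γ` on the unit ball of `(ℝ^k, ν)`. Only the values of `Φ` on
that ball matter. -/
def IsLipschitzOnUnitBall {X : Type u} [NormedAddCommGroup X] {k : ℕ}
    (γ : ℝ) (ν : Seminorm ℝ (Fin k → ℝ)) (Φ : (Fin k → ℝ) → X) : Prop :=
  ∀ y ∈ unitBall ν, ∀ y' ∈ unitBall ν, ‖Φ y - Φ y'‖ ≤ γ * ν (y - y')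

/-- The fixed Lipschitz width `d^γ(K, Y)_X`, where `Y = (ℝ^k, ν)`. -/
noncomputable def fixedLipschitzWidth {X : Type u} [NormedAddCommGroup X]
    (K : Set X) (γ : ℝ) {k : ℕ} (ν : Seminorm ℝ (Fin k → ℝ)) : ℝ≥0∞ :=
  ⨅ (Φ : (Fin k → ℝ) → X) (_ : IsLipschitzOnUnitBall γ ν Φ),
    ⨆ f ∈ K, ⨅ y ∈ unitBall ν, ‖f - Φ y‖ₑ

/-- The Lipschitz width `d_n^γ(K)_X` (for `γ ≥ 0`, `n ≥ 1`): the infimum of the fixed Lipschitz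
widths over all `1 ≤ k ≤ n` and all norms on `ℝ^k`. -/
noncomputable def lipschitzWidth {X : Type u} [NormedAddCommGroup X]
    (K : Set X) (n : ℕ) (γ : ℝ) : ℝ≥0∞ :=
  ⨅ (k : ℕ) (_ : 1 ≤ k) (_ : k ≤ n) (ν : Seminorm ℝ (Fin k → ℝ)) (_ : IsNormOn ν),
    fixedLipschitzWidth K γ ν

/-! Suppose every `n`-dimensional subspace `V` is the image of Euclidean `ℝ^n` under a linear `T_V`
with `‖y‖ ≤ ‖T_V y‖ ≤ D ‖y‖`. Since `K` lies in the unit ball, only the part of `V` of norm at most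
`2` matters for approximation, and `y ↦ 2 T_V y` covers it from the unit ball. Finitely many
subspaces `V_i` are handled at once by `k` extra coordinates `t` that act as a switch: `Φ(y, t) = ∑
tent_i(t) • 2 T_i y`, with tents of slope `c` whose apexes lie in `[-1, 1]^k` at mutual sup-distance
at least `2 / c`. The tents have disjoint supports, so the vector of their heights is `c`-Lipschitz
in the `ℓ_1` norm however many there are, and `Φ` has Lipschitz constant `2D(1 + c)`
(`lipschitzWidth_le_of_separated`). On a segment `m ≤ N` points allow `c = m`; the vertices of a
cube of dimension `⌈log₂ N⌉` allow `c = 1`.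

The value of `D` comes from maximising a determinant over the unit ball of a norm on matrices and
perturbing the maximiser along a unit vector `e`. With the operator norm this is John's theorem, `D
= √n`. For finite `p`, the subspace of `L_p` is encoded by a vector-valued function and the norm is
its `L_p` norm; the first-order condition at the maximiser `Φ`, with `F = ‖Φ‖` and `f = ⟪e, Φ⟫`, is
`n ∫ F^(p-2) f² = 1`. Together with `|f| ≤ F` and weighted AM-GM it pins `∫ |f|^p` well enough for
Lewis's exponent `|1/2 - 1/p|`. For `p = ∞` this exponent is `1/2`, which is John's case. -/

/-- The tent function of height `1`, slope `c` and apex `a`. -/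
noncomputable def tent {E : Type*} [NormedAddCommGroup E] (c : ℝ) (a x : E) : ℝ :=
  max 0 (1 - c * ‖x - a‖)

/-! ### Tents with separated apexes -/

section Tent

variable {E : Type*} [NormedAddCommGroup E] {c : ℝ}

theorem tent_nonneg (c : ℝ) (a x : E) : 0 ≤ tent c a x := le_max_left _ _

theorem tent_le_one (hc : 0 ≤ c) (a x : E) : tent c a x ≤ 1 :=
  max_le zero_le_one (by linarith [mul_nonneg hc (norm_nonneg (x - a))])

theorem tent_self (c : ℝ) (a : E) : tent c a a = 1 := by simp [tent]

theorem abs_tent_sub_le (hc : 0 ≤ c) (a x y : E) :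
    |tent c a x - tent c a y| ≤ c * ‖x - y‖ := by
  have h := abs_max_sub_max_le_abs (1 - c * ‖x - a‖) (1 - c * ‖y - a‖) 0
  rw [max_comm _ (0 : ℝ), max_comm _ (0 : ℝ)] at h
  refine h.trans ?_
  have h2 : 1 - c * ‖x - a‖ - (1 - c * ‖y - a‖) = c * (‖y - a‖ - ‖x - a‖) := by ring
  rw [h2, abs_mul, abs_of_nonneg hc]
  refine mul_le_mul_of_nonneg_left ?_ hc
  have := abs_norm_sub_norm_le (y - a) (x - a)
  rwa [sub_sub_sub_cancel_right, norm_sub_rev y x] at this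

/-- Where both tents are positive their sum is `2 - c‖x - a‖ - c‖y - b‖`, and the triangle
inequality along `a, x, y, b` finishes. Taking `x = y` shows that the supports are disjoint;
distinct `x, y` give the Lipschitz bound across two supports. -/
theorem tent_add_tent_le (hc : 0 ≤ c) {a b x y : E} (hab : 2 ≤ c * ‖a - b‖)
    (hx : 0 < tent c a x) (hy : 0 < tent c b y) :
    tent c a x + tent c b y ≤ c * ‖x - y‖ := by
  have hx' : tent c a x = 1 - c * ‖x - a‖ :=
    max_eq_right (le_of_not_gt fun h => by simp [tent, max_eq_left h.le] at hx)
  have hy' : tent c b y = 1 - c * ‖y - b‖ :=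
    max_eq_right (le_of_not_gt fun h => by simp [tent, max_eq_left h.le] at hy)
  have h : ‖a - b‖ ≤ ‖x - a‖ + ‖x - y‖ + ‖y - b‖ := by
    have e : a - b = -(x - a) + (x - y) + (y - b) := by abel
    rw [e, ← norm_neg (x - a)]
    exact norm_add₃_le
  have := mul_le_mul_of_nonneg_left h hc
  rw [hx', hy']
  linarith

variable {ι : Type*} {a : ι → E}

theorem tent_eq_zero_of_pos (hc : 0 ≤ c) (ha : ∀ i j, i ≠ j → 2 ≤ c * ‖a i - a j‖)
    {x : E} {i j : ι} (hi : 0 < tent c (a i) x) (hij : j ≠ i) : tent c (a j) x = 0 := by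
  by_contra h
  have hj := lt_of_le_of_ne (tent_nonneg c (a j) x) (Ne.symm h)
  have := tent_add_tent_le hc (ha j i hij) hj hi
  simp only [sub_self, norm_zero, mul_zero] at this
  linarith

theorem sum_tent_le_one [Fintype ι] (hc : 0 ≤ c) (ha : ∀ i j, i ≠ j → 2 ≤ c * ‖a i - a j‖)
    (x : E) : ∑ i, tent c (a i) x ≤ 1 := by
  by_cases h : ∃ i, 0 < tent c (a i) x
  · obtain ⟨i, hi⟩ := h
    rw [Finset.sum_eq_single i (fun j _ hj => tent_eq_zero_of_pos hc ha hi hj) (by simp)]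
    exact tent_le_one hc _ _
  · push Not at h
    exact (Finset.sum_nonpos fun i _ => h i).trans zero_le_one

/-- At most two terms survive, one for the tent active at `x` and one for the tent active at `y`.
Hence the constant is `c`, independent of the number of tents. -/
theorem sum_abs_tent_sub_le [Fintype ι] (hc : 0 ≤ c)
    (ha : ∀ i j, i ≠ j → 2 ≤ c * ‖a i - a j‖) (x y : E) :
    ∑ i, |tent c (a i) x - tent c (a i) y| ≤ c * ‖x - y‖ := by
  have key : ∀ i, (∀ j, j ≠ i → tent c (a j) x = 0) → (∀ j, j ≠ i → tent c (a j) y = 0) →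
      ∑ i, |tent c (a i) x - tent c (a i) y| ≤ c * ‖x - y‖ := by
    intro i h1 h2
    rw [Finset.sum_eq_single i (fun j _ hj => by rw [h1 j hj, h2 j hj]; simp) (by simp)]
    exact abs_tent_sub_le hc _ _ _
  have zero : ∀ z : E, (¬ ∃ i, 0 < tent c (a i) z) → ∀ i, tent c (a i) z = 0 := by
    intro z h i
    push Not at h
    exact le_antisymm (h i) (tent_nonneg _ _ _)
  by_cases hx : ∃ i, 0 < tent c (a i) x
  · obtain ⟨i, hi⟩ := hx
    by_cases hy : ∃ i, 0 < tent c (a i) y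
    · obtain ⟨k, hk⟩ := hy
      by_cases hik : i = k
      · subst hik
        exact key i (fun j hj => tent_eq_zero_of_pos hc ha hi hj)
          (fun j hj => tent_eq_zero_of_pos hc ha hk hj)
      · calc ∑ i, |tent c (a i) x - tent c (a i) y|
            ≤ ∑ i, (tent c (a i) x + tent c (a i) y) := by
              refine Finset.sum_le_sum fun j _ => ?_
              have h1 := tent_nonneg c (a j) x
              have h2 := tent_nonneg c (a j) y
              rw [abs_le]
              constructor <;> linarith
          _ = tent c (a i) x + tent c (a k) y := by
              rw [Finset.sum_add_distrib,
                Finset.sum_eq_single i (fun j _ hj => tent_eq_zero_of_pos hc ha hi hj) (by simp),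
                Finset.sum_eq_single k (fun j _ hj => tent_eq_zero_of_pos hc ha hk hj) (by simp)]
          _ ≤ c * ‖x - y‖ := tent_add_tent_le hc (ha i k hik) hi hk
    · exact key i (fun j hj => tent_eq_zero_of_pos hc ha hi hj) (fun j _ => zero y hy j)
  · by_cases hy : ∃ i, 0 < tent c (a i) y
    · obtain ⟨k, hk⟩ := hy
      exact key k (fun j _ => zero x hx j) (fun j hj => tent_eq_zero_of_pos hc ha hk hj)
    · rw [Finset.sum_eq_zero fun j _ => by rw [zero x hx j, zero y hy j]; simp]
      exact mul_nonneg hc (norm_nonneg _)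

end Tent

/-! ### The norm on `ℝ^n × ℝ^k` and the gluing of subspaces -/

/-- The projection of `ℝ^(n+k)` onto the first `n` coordinates, with the Euclidean structure. -/
noncomputable def headProj (n k : ℕ) : (Fin (n + k) → ℝ) →ₗ[ℝ] EuclideanSpace ℝ (Fin n) :=
  (WithLp.linearEquiv 2 ℝ (Fin n → ℝ)).symm.toLinearMap ∘ₗ
    LinearMap.funLeft ℝ ℝ (Fin.castAdd k)

/-- The projection of `ℝ^(n+k)` onto the last `k` coordinates. -/
noncomputable def tailProj (n k : ℕ) : (Fin (n + k) → ℝ) →ₗ[ℝ] (Fin k → ℝ) :=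
  LinearMap.funLeft ℝ ℝ (Fin.natAdd n)

/-- The norm `max (‖y‖₂, ‖t‖_∞)` on `ℝ^n × ℝ^k`. -/
noncomputable def mixedNorm (n k : ℕ) : Seminorm ℝ (Fin (n + k) → ℝ) :=
  (normSeminorm ℝ _).comp (headProj n k) ⊔ (normSeminorm ℝ _).comp (tailProj n k)

theorem mixedNorm_apply (n k : ℕ) (z : Fin (n + k) → ℝ) :
    mixedNorm n k z = max ‖headProj n k z‖ ‖tailProj n k z‖ := rfl

theorem isNormOn_mixedNorm (n k : ℕ) : IsNormOn (mixedNorm n k) := by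
  intro z hz
  rw [mixedNorm_apply] at hz
  have h1 : headProj n k z = 0 := norm_le_zero_iff.1 ((le_max_left _ _).trans hz.le)
  have h2 : tailProj n k z = 0 := norm_le_zero_iff.1 ((le_max_right _ _).trans hz.le)
  funext i
  refine Fin.addCases (fun i => ?_) (fun i => ?_) i
  · exact congrArg (fun y : EuclideanSpace ℝ (Fin n) => y i) h1
  · exact congrFun h2 i

theorem exists_headProj_eq_tailProj_eq {n k : ℕ} (y : EuclideanSpace ℝ (Fin n))
    (t : Fin k → ℝ) : ∃ z, headProj n k z = y ∧ tailProj n k z = t := by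
  refine ⟨Fin.append (fun i => y i) t, ?_, ?_⟩
  · ext i
    simp [headProj, LinearMap.funLeft_apply]
  · ext i
    simp [tailProj, LinearMap.funLeft_apply]

/-- If the subspaces `V i` are images of the Euclidean space `ℝ^n` under linear maps of distortion
`D`, then those maps can be glued along separated points of the unit cube of `ℝ^k`. -/
theorem lipschitzWidth_le_of_separated {X : Type u} [NormedAddCommGroup X] [NormedSpace ℝ X]
    {K : Set X} (hK : ∀ f ∈ K, ‖f‖ ≤ 1) {n k : ℕ} (hn : 1 ≤ n) {ι : Type*} [Fintype ι]
    (V : ι → Submodule ℝ X) {D c γ : ℝ} (hD : 0 ≤ D) (hc : 0 ≤ c) (hγ : 2 * D * (1 + c) ≤ γ)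
    (T : ι → EuclideanSpace ℝ (Fin n) →ₗ[ℝ] X) (hT : ∀ i y, ‖T i y‖ ≤ D * ‖y‖)
    (hV : ∀ i, ∀ g ∈ V i, ∃ y, T i y = g ∧ ‖y‖ ≤ ‖g‖)
    (a : ι → Fin k → ℝ) (ha1 : ∀ i, ‖a i‖ ≤ 1) (ha : ∀ i j, i ≠ j → 2 ≤ c * ‖a i - a j‖) :
    lipschitzWidth K (n + k) γ ≤ ⨆ f ∈ K, ⨅ i, Metric.infEDist f (V i : Set X) := by
  -- The factor `2` lets the Euclidean unit ball cover all `g ∈ V i` with `‖g‖ ≤ 2`.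
  set Φ : (Fin (n + k) → ℝ) → X := fun z =>
    ∑ i, tent c (a i) (tailProj n k z) • (2 : ℝ) • T i (headProj n k z) with hΦ
  have hbd : ∀ i y, ‖(2 : ℝ) • T i y‖ ≤ 2 * D * ‖y‖ := by
    intro i y
    rw [norm_smul, Real.norm_ofNat, mul_assoc]
    exact mul_le_mul_of_nonneg_left (hT i y) zero_le_two
  have hLip : IsLipschitzOnUnitBall γ (mixedNorm n k) Φ := by
    intro z _ z' hz'
    set ν := mixedNorm n k (z - z') with hν
    have hν0 : 0 ≤ ν := apply_nonneg _ _
    have h1 : ‖headProj n k z - headProj n k z'‖ ≤ ν := by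
      rw [← map_sub]; exact le_max_left _ _
    have h2 : ‖tailProj n k z - tailProj n k z'‖ ≤ ν := by
      rw [← map_sub]; exact le_max_right _ _
    have h3 : ‖headProj n k z'‖ ≤ 1 := (le_max_left _ _).trans hz'
    -- Discrete product rule: varying the head costs `2D`, as the tents sum to at most `1`; varying
    -- the tail costs `2Dc`, as the head of `z'` lies in the unit ball.
    have e : Φ z - Φ z' =
        ∑ i, (tent c (a i) (tailProj n k z) •
            (2 : ℝ) • T i (headProj n k z - headProj n k z') +
          (tent c (a i) (tailProj n k z) - tent c (a i) (tailProj n k z')) •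
            (2 : ℝ) • T i (headProj n k z')) := by
      rw [hΦ, ← Finset.sum_sub_distrib]
      refine Finset.sum_congr rfl fun i _ => ?_
      rw [map_sub]
      module
    have hDν : 0 ≤ 2 * D * ν := by positivity
    calc ‖Φ z - Φ z'‖
        ≤ ∑ i, (tent c (a i) (tailProj n k z) * (2 * D * ν) +
          |tent c (a i) (tailProj n k z) - tent c (a i) (tailProj n k z')| * (2 * D)) := by
          rw [e]
          refine norm_sum_le_of_le _ fun i _ => (norm_add_le _ _).trans (add_le_add ?_ ?_)
          · rw [norm_smul, Real.norm_of_nonneg (tent_nonneg _ _ _)]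
            refine mul_le_mul_of_nonneg_left ((hbd _ _).trans ?_) (tent_nonneg _ _ _)
            exact mul_le_mul_of_nonneg_left h1 (by positivity)
          · rw [norm_smul, Real.norm_eq_abs]
            refine mul_le_mul_of_nonneg_left ((hbd _ _).trans ?_) (abs_nonneg _)
            exact mul_le_of_le_one_right (by positivity) h3
      _ = (∑ i, tent c (a i) (tailProj n k z)) * (2 * D * ν) +
          (∑ i, |tent c (a i) (tailProj n k z) - tent c (a i) (tailProj n k z')|) * (2 * D) := by
          rw [Finset.sum_add_distrib, Finset.sum_mul, Finset.sum_mul]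
      _ ≤ 1 * (2 * D * ν) + (c * ν) * (2 * D) := by
          refine add_le_add (mul_le_mul_of_nonneg_right (sum_tent_le_one hc ha _) hDν)
            (mul_le_mul_of_nonneg_right ?_ (by positivity))
          exact (sum_abs_tent_sub_le hc ha _ _).trans (mul_le_mul_of_nonneg_left h2 hc)
      _ = 2 * D * (1 + c) * ν := by ring
      _ ≤ γ * ν := mul_le_mul_of_nonneg_right hγ hν0
  have hΦa : ∀ i z, tailProj n k z = a i → Φ z = (2 : ℝ) • T i (headProj n k z) := by
    intro i z hz
    rw [hΦ]
    simp only [hz]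
    rw [Finset.sum_eq_single i _ (by simp), tent_self, one_smul]
    intro j _ hj
    rw [tent_eq_zero_of_pos hc ha (i := i) _ hj, zero_smul]
    rw [tent_self]
    exact one_pos
  have hle : lipschitzWidth K (n + k) γ ≤ fixedLipschitzWidth K γ (mixedNorm n k) :=
    iInf_le_of_le (n + k) <| iInf_le_of_le (by omega) <| iInf_le_of_le le_rfl <|
      iInf_le_of_le (mixedNorm n k) <| iInf_le_of_le (isNormOn_mixedNorm n k) le_rfl
  refine hle.trans (iInf_le_of_le Φ <| iInf_le_of_le hLip ?_)
  refine iSup₂_mono fun f hf => le_iInf fun i => Metric.le_infEDist.2 fun g hg => ?_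
  have main : ∀ g ∈ V i, ‖g‖ ≤ 2 →
      ⨅ y ∈ unitBall (mixedNorm n k), ‖f - Φ y‖ₑ ≤ ‖f - g‖ₑ := by
    intro g hg hg2
    obtain ⟨y, rfl, hy⟩ := hV i g hg
    obtain ⟨z, hz1, hz2⟩ := exists_headProj_eq_tailProj_eq ((2 : ℝ)⁻¹ • y) (a i)
    refine iInf₂_le_of_le z ?_ ?_
    · change max _ _ ≤ (1 : ℝ)
      refine max_le ?_ ?_
      · change ‖headProj n k z‖ ≤ 1
        rw [hz1, norm_smul, norm_inv, Real.norm_ofNat]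
        linarith
      · change ‖tailProj n k z‖ ≤ 1
        rw [hz2]
        exact ha1 i
    · rw [hΦa i z hz2, hz1, map_smul, smul_inv_smul₀ two_ne_zero]
  rw [edist_eq_enorm_sub]
  -- If `‖g‖ > 2`, then `‖f - g‖ > 1 ≥ ‖f‖`, so `0 ∈ V i` approximates `f` better than `g` does.
  by_cases hg2 : ‖g‖ ≤ 2
  · exact main g hg hg2
  · refine (main 0 (V i).zero_mem (by simp)).trans ?_
    rw [sub_zero, enorm_le_iff_norm_le]
    have h1 := hK f hf
    have h2 := norm_sub_norm_le g f
    rw [norm_sub_rev] at h2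
    push Not at hg2
    linarith

/-- Lipschitz widths are bounded by nonlinear Kolmogorov widths as soon as every `n`-dimensional
subspace has Banach-Mazur distance at most `D` from the Euclidean space. -/
theorem lipschitzWidth_le_nonlinearKolmogorovWidth {X : Type u} [NormedAddCommGroup X]
    [NormedSpace ℝ X] {K : Set X} (hK : ∀ f ∈ K, ‖f‖ ≤ 1) {n : ℕ} (hn : 1 ≤ n) {N : ℝ}
    (hN : 1 < N) {D : ℝ} (hD : 0 ≤ D)
    (hX : ∀ V : Submodule ℝ X, Module.rank ℝ V = n →
      ∃ T : EuclideanSpace ℝ (Fin n) →ₗ[ℝ] X, (∀ y, T y ∈ V) ∧ (∀ y, ‖y‖ ≤ ‖T y‖) ∧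
        ∀ y, ‖T y‖ ≤ D * ‖y‖) :
    lipschitzWidth K (n + 1) (2 * (N + 1) * D) ≤ nonlinearKolmogorovWidth K n N ∧
      lipschitzWidth K (n + ⌈Real.logb 2 N⌉₊) (6 * D) ≤ nonlinearKolmogorovWidth K n N := by
  have hX' : ∀ V : Submodule ℝ X, Module.rank ℝ V = n →
      ∃ T : EuclideanSpace ℝ (Fin n) →ₗ[ℝ] X, (∀ y, ‖T y‖ ≤ D * ‖y‖) ∧
        ∀ g ∈ V, ∃ y, T y = g ∧ ‖y‖ ≤ ‖g‖ := by
    intro V hV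
    obtain ⟨T, h1, h2, h3⟩ := hX V hV
    refine ⟨T, h3, fun g hg => ?_⟩
    have : FiniteDimensional ℝ V := Module.finite_of_rank_eq_nat hV
    have hinj : Function.Injective (T.codRestrict V h1) := by
      rw [← LinearMap.ker_eq_bot, LinearMap.ker_eq_bot']
      intro y hy
      have h0 : T y = 0 := congrArg Subtype.val hy
      have := h2 y
      rw [h0, norm_zero] at this
      exact norm_le_zero_iff.1 this
    have hsurj := (LinearMap.injective_iff_surjective_of_finrank_eq_finrank
      (by rw [finrank_euclideanSpace_fin, Module.finrank_eq_of_rank_eq hV])).1 hinj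
    obtain ⟨y, hy⟩ := hsurj ⟨g, hg⟩
    have hy' : T y = g := congrArg Subtype.val hy
    exact ⟨y, hy', hy' ▸ h2 y⟩
  have hbound : ∀ (k : ℕ) (c γ : ℝ), 0 ≤ c → 2 * D * (1 + c) ≤ γ →
      ∀ L : Finset (Submodule ℝ X), (∀ V ∈ L, Module.rank ℝ V = (n : Cardinal)) →
      ∀ a : L → Fin k → ℝ, (∀ i, ‖a i‖ ≤ 1) → (∀ i j, i ≠ j → 2 ≤ c * ‖a i - a j‖) →
      lipschitzWidth K (n + k) γ ≤ ⨆ f ∈ K, ⨅ V ∈ L, Metric.infEDist f (V : Set X) := by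
    intro k c γ hc hγ L hL a ha1 ha
    choose T hT hT' using fun i : L => hX' i (hL i i.2)
    refine (lipschitzWidth_le_of_separated hK hn (fun i : L => (i : Submodule ℝ X)) hD hc hγ T hT
      hT' a ha1 ha).trans_eq ?_
    simp only [iInf_subtype]
  have hn0 : n ≠ 0 := by omega
  simp only [nonlinearKolmogorovWidth, if_neg hn0]
  refine ⟨le_iInf fun L => le_iInf fun hLN => le_iInf fun hL => ?_,
    le_iInf fun L => le_iInf fun hLN => le_iInf fun hL => ?_⟩
  · set m : ℝ := (L.card : ℝ) with hm
    have hm0 : 0 ≤ m := Nat.cast_nonneg _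
    -- The apexes are the midpoints of `m` equal subintervals of `[-1, 1]`; neighbours are `2 / m`
    -- apart, so slope `m ≤ N` suffices. For empty `L` there is no apex, and the division by `m = 0`
    -- is never evaluated.
    refine hbound 1 m _ hm0 ?_ L hL
      (fun i _ => -1 + (2 * ((L.equivFin i : ℕ) : ℝ) + 1) / m) (fun i => ?_) (fun i j hij => ?_)
    · nlinarith [mul_nonneg hD (sub_nonneg.2 hLN)]
    · have hi : ((L.equivFin i : ℕ) : ℝ) + 1 ≤ m := by
        rw [hm]
        exact_mod_cast (L.equivFin i).2
      have hi0 : (0 : ℝ) ≤ ((L.equivFin i : ℕ) : ℝ) := Nat.cast_nonneg _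
      have hmpos : 0 < m := by linarith
      rw [pi_norm_const, Real.norm_eq_abs, abs_le]
      constructor
      · have : 0 ≤ (2 * ((L.equivFin i : ℕ) : ℝ) + 1) / m := by positivity
        linarith
      · have : (2 * ((L.equivFin i : ℕ) : ℝ) + 1) / m ≤ 2 := by
          rw [div_le_iff₀ hmpos]; linarith
        linarith
    · have hi : ((L.equivFin i : ℕ) : ℝ) + 1 ≤ m := by
        rw [hm]
        exact_mod_cast (L.equivFin i).2
      have hi0 : (0 : ℝ) ≤ ((L.equivFin i : ℕ) : ℝ) := Nat.cast_nonneg _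
      have hmpos : 0 < m := by linarith
      have hne : ((L.equivFin i : ℕ) : ℤ) - ((L.equivFin j : ℕ) : ℤ) ≠ 0 := by
        rw [sub_ne_zero]
        exact fun h => hij (L.equivFin.injective (Fin.ext (by exact_mod_cast h)))
      have hone : (1 : ℝ) ≤ |((L.equivFin i : ℕ) : ℝ) - ((L.equivFin j : ℕ) : ℝ)| := by
        exact_mod_cast Int.one_le_abs hne
      have e : ((fun _ => -1 + (2 * ((L.equivFin i : ℕ) : ℝ) + 1) / m) -
          fun _ => -1 + (2 * ((L.equivFin j : ℕ) : ℝ) + 1) / m : Fin 1 → ℝ) =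
          fun _ => 2 * (((L.equivFin i : ℕ) : ℝ) - ((L.equivFin j : ℕ) : ℝ)) / m := by
        funext _
        simp only [Pi.sub_apply]
        ring
      rw [e, pi_norm_const, Real.norm_eq_abs, abs_div, abs_of_pos hmpos, abs_mul, abs_two,
        mul_div_cancel₀ _ hmpos.ne']
      linarith
  · set k := ⌈Real.logb 2 N⌉₊ with hk
    have hcard : Fintype.card L ≤ Fintype.card (Fin k → Bool) := by
      have h1 : N ≤ (2 : ℝ) ^ (k : ℝ) := by
        rw [← Real.logb_le_iff_le_rpow one_lt_two (by linarith)]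
        exact Nat.le_ceil _
      rw [Real.rpow_natCast] at h1
      simp only [Fintype.card_coe, Fintype.card_pi, Fintype.card_bool, Finset.prod_const,
        Finset.card_univ, Fintype.card_fin]
      exact_mod_cast hLN.trans h1
    obtain ⟨ε⟩ := Function.Embedding.nonempty_of_card_le hcard
    -- The apexes are vertices of the cube `{-1, 1}^k`, at mutual sup-distance `2`, so slope `1`
    -- suffices. The Lipschitz constant is then `4D`, below the allowed `6D`.
    refine hbound k 1 _ zero_le_one (by linarith) L hL
      (fun i j => if ε i j then 1 else -1) (fun i => ?_) (fun i j hij => ?_)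
    · rw [pi_norm_le_iff_of_nonneg zero_le_one]
      intro l
      split_ifs <;> simp
    · obtain ⟨l, hl⟩ := Function.ne_iff.1 (ε.injective.ne hij)
      rw [one_mul]
      refine le_trans ?_ (norm_le_pi_norm _ l)
      rw [Pi.sub_apply]
      generalize ε i l = p at hl
      generalize ε j l = q at hl
      cases p <;> cases q <;> first | exact absurd rfl hl | norm_num

/-! ### Maximising the determinant -/

section Determinant

variable {E Z : Type*} [NormedAddCommGroup E] [NormedSpace ℝ E] [FiniteDimensional ℝ E]
  [Nontrivial E] [NormedAddCommGroup Z] [NormedSpace ℝ Z]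

/-- Lewis's determinant maximisation: for a norm `‖J ·‖` on the endomorphisms of `E`, there is a
unit vector `A` at which the determinant is maximal. -/
theorem exists_norm_eq_one_abs_det_le (J : (E →L[ℝ] E) →ₗ[ℝ] Z) (hJ : Function.Injective J) :
    ∃ A : E →L[ℝ] E, A.det ≠ 0 ∧ ‖J A‖ = 1 ∧
      ∀ B : E →L[ℝ] E, |B.det| ≤ |A.det| * ‖J B‖ ^ Module.finrank ℝ E := by
  have hJc : Continuous J := J.continuous_of_finiteDimensional
  have hn : Module.finrank ℝ E ≠ 0 := Module.finrank_pos.ne'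
  obtain ⟨C, -, hC⟩ := J.injective_iff_antilipschitz.1 hJ
  have hcpt : IsCompact {A : E →L[ℝ] E | ‖J A‖ ≤ 1} := by
    refine Metric.isCompact_of_isClosed_isBounded
      (isClosed_le hJc.norm continuous_const) ?_
    refine (Metric.isBounded_closedBall (x := (0 : E →L[ℝ] E)) (r := C)).subset fun A hA => ?_
    rw [mem_closedBall_zero_iff]
    have h := hC.le_mul_dist A 0
    rw [map_zero, dist_zero_right, dist_zero_right] at h
    exact h.trans (mul_le_of_le_one_right C.2 hA)
  obtain ⟨A, hA, hmax⟩ := hcpt.exists_isMaxOn ⟨0, by simp⟩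
    (ContinuousLinearMap.continuous_det (𝕜 := ℝ) (E := E)).abs.continuousOn
  have hpos : ∀ B : E →L[ℝ] E, B ≠ 0 → 0 < ‖J B‖ := fun B hB =>
    norm_pos_iff.2 fun h => hB (hJ (h.trans (map_zero J).symm))
  have hdet : ∀ (r : ℝ) (B : E →L[ℝ] E), (r • B).det = r ^ Module.finrank ℝ E * B.det := by
    intro r B
    simp [ContinuousLinearMap.det, LinearMap.det_smul]
  -- The determinant is homogeneous of degree `dim E`, so maximality on the unit ball extends to all
  -- `B`.
  have hle : ∀ B : E →L[ℝ] E, |B.det| ≤ |A.det| * ‖J B‖ ^ Module.finrank ℝ E := by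
    intro B
    by_cases hB : B = 0
    · subst hB
      have h0 := hdet 0 0
      rw [smul_zero, zero_pow hn, zero_mul] at h0
      rw [h0, abs_zero]
      positivity
    · have hr := hpos B hB
      have h := hmax (a := ‖J B‖⁻¹ • B) (by
        simp only [Set.mem_ofPred_eq, map_smul, norm_smul, norm_inv, norm_norm]
        rw [inv_mul_cancel₀ hr.ne'])
      simp only [Set.mem_ofPred_eq, hdet, abs_mul, abs_pow, abs_inv, abs_norm, inv_pow] at h
      rwa [inv_mul_le_iff₀ (by positivity), mul_comm] at h
  have hA0 : A.det ≠ 0 := by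
    intro h0
    have h := hle (ContinuousLinearMap.id ℝ E)
    rw [h0, abs_zero, zero_mul] at h
    simp [ContinuousLinearMap.det] at h
    linarith
  refine ⟨A, hA0, le_antisymm hA ?_, hle⟩
  have h := hle A
  have h1 : 1 ≤ ‖J A‖ ^ Module.finrank ℝ E := by
    by_contra hlt
    push Not at hlt
    have := mul_lt_mul_of_pos_left hlt (abs_pos.2 hA0)
    linarith
  by_contra hlt
  push Not at hlt
  exact absurd h1 (not_le.2 (pow_lt_one₀ (norm_nonneg _) hlt hn))

end Determinant

theorem ContinuousLinearMap.det_comp_eq {E : Type*} [NormedAddCommGroup E] [NormedSpace ℝ E]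
    (A B : E →L[ℝ] E) :
    (A.comp B).det = A.det * B.det := by
  simp [ContinuousLinearMap.det, LinearMap.det_comp]

/-! ### Rank-one perturbations and John's theorem -/

section RankOne

open scoped RealInnerProductSpace

variable {E : Type*} [NormedAddCommGroup E] [InnerProductSpace ℝ E]

/-- The perturbation `y ↦ y + t ⟪e, y⟫ e` of the identity. -/
noncomputable def stretch (e : E) (t : ℝ) : E →L[ℝ] E :=
  ContinuousLinearMap.id ℝ E + (t • innerSL ℝ e).smulRight e

theorem stretch_apply (e : E) (t : ℝ) (y : E) : stretch e t y = y + (t * ⟪e, y⟫) • e := rfl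

theorem det_stretch [FiniteDimensional ℝ E] {e : E} (he : ‖e‖ = 1) (t : ℝ) :
    (stretch e t).det = 1 + t := by
  have h : (stretch e t : E →ₗ[ℝ] E) =
      LinearMap.transvection ((t • innerSL ℝ e : E →L[ℝ] ℝ) : E →ₗ[ℝ] ℝ) e := by
    ext y
    simp [stretch_apply, LinearMap.transvection.apply]
  rw [ContinuousLinearMap.det, h, LinearMap.transvection.det]
  simp [he]

/-- With `(1 + t)² = 1 + s` the squared norm becomes linear in `s`, while the squared determinant is
`1 + s`. -/
theorem norm_stretch_sq {e : E} (he : ‖e‖ = 1) (t : ℝ) (y : E) :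
    ‖stretch e t y‖ ^ 2 = ‖y‖ ^ 2 + ((1 + t) ^ 2 - 1) * ⟪e, y⟫ ^ 2 := by
  rw [stretch_apply, norm_add_sq_real, inner_smul_right, norm_smul, he, mul_one, Real.norm_eq_abs,
    sq_abs, real_inner_comm]
  ring

theorem inner_stretch (e : E) (t : ℝ) (x y : E) : ⟪x, stretch e t y⟫ = ⟪stretch e t x, y⟫ := by
  simp only [stretch_apply, inner_add_left, inner_add_right, inner_smul_left, inner_smul_right,
    real_inner_comm x e]
  simp
  ring

/-- A map maximising the determinant for the operator norm does not contract by more than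
`√(dim E)`. -/
theorem one_le_finrank_mul_norm_sq [FiniteDimensional ℝ E] {X : Type*} [NormedAddCommGroup X]
    [NormedSpace ℝ X] {u : E →L[ℝ] X} (hu : ‖u‖ ≤ 1)
    (h : ∀ B : E →L[ℝ] E, |B.det| ≤ ‖u.comp B‖ ^ Module.finrank ℝ E) {e : E} (he : ‖e‖ = 1) :
    1 ≤ Module.finrank ℝ E * ‖u e‖ ^ 2 := by
  set n := Module.finrank ℝ E
  set δ := ‖u e‖
  -- Testing maximality on a stretch gives `1 + s ≤ (1 + sδ²)^n ≤ exp(nsδ²)`. Taking logarithms and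
  -- dividing by `s` leaves a bound whose limit at `s → 0⁺` is the claim.
  have key : ∀ s : ℝ, 0 < s → 1 / (1 + s) ≤ n * δ ^ 2 := by
    intro s hs
    set t := √(1 + s) - 1 with ht
    have ht2 : (1 + t) ^ 2 = 1 + s := by
      rw [ht, add_sub_cancel, Real.sq_sqrt (by linarith)]
    have hbd : ‖u.comp (stretch e t)‖ ≤ √(1 + s * δ ^ 2) := by
      refine ContinuousLinearMap.opNorm_le_bound _ (Real.sqrt_nonneg _) fun y => ?_
      -- Duality: a norming functional pulls back along `u` to a vector `θ` with `‖θ‖ ≤ 1` and `|⟪e,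
      -- θ⟫| ≤ δ`. The stretch is self-adjoint, so it can act on `θ`, where its effect on the norm
      -- is explicit.
      obtain ⟨φ, hφ, hφy⟩ := exists_dual_vector'' ℝ (u (stretch e t y))
      set θ := (InnerProductSpace.toDual ℝ E).symm (φ.comp u) with hθ
      have hθy : ∀ z, ⟪θ, z⟫ = φ (u z) := fun z => by
        rw [hθ, InnerProductSpace.toDual_symm_apply]; rfl
      have hθ1 : ‖θ‖ ≤ 1 := by
        rw [hθ, LinearIsometryEquiv.norm_map]
        exact (φ.opNorm_comp_le u).trans (mul_le_one₀ hφ (norm_nonneg _) hu)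
      have hθe : ⟪e, θ⟫ ^ 2 ≤ δ ^ 2 := by
        rw [real_inner_comm, hθy, ← sq_abs]
        refine pow_le_pow_left₀ (abs_nonneg _) ?_ 2
        exact (φ.le_opNorm _).trans (mul_le_of_le_one_left (norm_nonneg _) hφ)
      have e1 : ‖u.comp (stretch e t) y‖ = ⟪stretch e t θ, y⟫ := by
        rw [← inner_stretch, hθy, hφy]
        rfl
      rw [e1]
      refine (real_inner_le_norm _ _).trans (mul_le_mul_of_nonneg_right ?_ (norm_nonneg _))
      refine Real.le_sqrt_of_sq_le ?_
      rw [norm_stretch_sq he, ht2, add_sub_cancel_left]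
      have := pow_le_one₀ (norm_nonneg _) hθ1 (n := 2)
      nlinarith
    have h1 := (h (stretch e t)).trans (pow_le_pow_left₀ (norm_nonneg _) hbd n)
    have h2 := pow_le_pow_left₀ (abs_nonneg _) h1 2
    rw [sq_abs, det_stretch he, ht2, ← pow_mul, mul_comm n 2, pow_mul,
      Real.sq_sqrt (by positivity)] at h2
    have h3 : (1 + s * δ ^ 2) ^ n ≤ Real.exp (n * (s * δ ^ 2)) := by
      rw [Real.exp_nat_mul]
      refine pow_le_pow_left₀ (by positivity) ?_ n
      rw [add_comm]
      exact Real.add_one_le_exp _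
    have h4 : Real.log (1 + s) ≤ n * (s * δ ^ 2) :=
      (Real.log_le_iff_le_exp (by linarith)).2 (h2.trans h3)
    have h5 := Real.one_sub_inv_le_log_of_pos (show 0 < 1 + s by linarith)
    have h6 : 1 - (1 + s)⁻¹ = s * (1 / (1 + s)) := by
      field_simp
      ring
    have h7 : s * (1 / (1 + s)) ≤ s * (n * δ ^ 2) := by
      rw [← h6]
      linarith
    exact le_of_mul_le_mul_left h7 hs
  have hlim : Filter.Tendsto (fun s : ℝ => 1 / (1 + s)) (nhdsWithin 0 (Set.Ioi 0))
      (nhds (1 / (1 + 0))) := by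
    refine Filter.Tendsto.mono_left ?_ nhdsWithin_le_nhds
    refine ContinuousAt.tendsto ?_
    fun_prop (disch := norm_num)
  rw [add_zero, div_one] at hlim
  exact le_of_tendsto hlim (eventually_nhdsWithin_of_forall fun s hs => key s hs)

end RankOne

/-- A linear map is bounded by its values on unit vectors. -/
theorem le_norm_map_of_unit {E X : Type*} [NormedAddCommGroup E] [NormedSpace ℝ E]
    [NormedAddCommGroup X] [NormedSpace ℝ X] (T : E →ₗ[ℝ] X) {a b : ℝ}
    (h : ∀ e, ‖e‖ = 1 → a ≤ ‖T e‖ ∧ ‖T e‖ ≤ b) (y : E) :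
    a * ‖y‖ ≤ ‖T y‖ ∧ ‖T y‖ ≤ b * ‖y‖ := by
  by_cases hy : y = 0
  · simp [hy]
  · have hy' : 0 < ‖y‖ := norm_pos_iff.2 hy
    have h1 := h (‖y‖⁻¹ • y) (by rw [norm_smul, norm_inv, norm_norm, inv_mul_cancel₀ hy'.ne'])
    rw [map_smul, norm_smul, norm_inv, norm_norm, le_inv_mul_iff₀ hy', inv_mul_le_iff₀ hy'] at h1
    exact ⟨by linarith [h1.1], by linarith [h1.2]⟩

/-- **John's theorem**: an `n`-dimensional normed space has Banach-Mazur distance at most `√n` from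
the Euclidean space. -/
theorem exists_euclidean_distortion_le_sqrt {X : Type*} [NormedAddCommGroup X] [NormedSpace ℝ X]
    {n : ℕ} (hn : 1 ≤ n) (V : Submodule ℝ X) (hV : Module.rank ℝ V = n) :
    ∃ T : EuclideanSpace ℝ (Fin n) →ₗ[ℝ] X, (∀ y, T y ∈ V) ∧ (∀ y, ‖y‖ ≤ ‖T y‖) ∧
      ∀ y, ‖T y‖ ≤ √(n : ℝ) * ‖y‖ := by
  have : FiniteDimensional ℝ V := Module.finite_of_rank_eq_nat hV
  have : Nonempty (Fin n) := ⟨⟨0, hn⟩⟩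
  have hfr : Module.finrank ℝ (EuclideanSpace ℝ (Fin n)) = n := finrank_euclideanSpace_fin
  let u₀ : EuclideanSpace ℝ (Fin n) ≃L[ℝ] V :=
    (LinearEquiv.ofFinrankEq _ _ (by
      rw [hfr, Module.finrank_eq_of_rank_eq hV])).toContinuousLinearEquiv
  let u₁ : EuclideanSpace ℝ (Fin n) →L[ℝ] X := V.subtypeL.comp (u₀ : _ →L[ℝ] V)
  let J : (EuclideanSpace ℝ (Fin n) →L[ℝ] EuclideanSpace ℝ (Fin n)) →ₗ[ℝ]
      (EuclideanSpace ℝ (Fin n) →L[ℝ] X) :=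
    { toFun := fun A => u₁.comp A
      map_add' := fun A B => by simp
      map_smul' := fun r A => by simp }
  have hJ : Function.Injective J := by
    intro A B hAB
    ext1 y
    have h : u₁ (A y) = u₁ (B y) := congrArg (fun f => f y) hAB
    exact u₀.injective (Subtype.ext h)
  obtain ⟨A, hA, hA1, hmax⟩ := exists_norm_eq_one_abs_det_le J hJ
  -- Composing with `A` and cancelling `det A` moves the maximum to the identity.
  have hmax' : ∀ B : EuclideanSpace ℝ (Fin n) →L[ℝ] EuclideanSpace ℝ (Fin n),
      |B.det| ≤ ‖(u₁.comp A).comp B‖ ^ Module.finrank ℝ (EuclideanSpace ℝ (Fin n)) := by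
    intro B
    have h := hmax (A.comp B)
    rw [ContinuousLinearMap.det_comp_eq, abs_mul] at h
    exact le_of_mul_le_mul_left h (abs_pos.2 hA)
  have hA1' : ‖u₁.comp A‖ = 1 := hA1
  have hsq : 0 < √(n : ℝ) := Real.sqrt_pos.2 (by exact_mod_cast hn)
  have hbd := le_norm_map_of_unit (√(n : ℝ) • (u₁.comp A : EuclideanSpace ℝ (Fin n) →ₗ[ℝ] X))
    (a := 1) (b := √(n : ℝ)) (fun e he => by
      have h := one_le_finrank_mul_norm_sq hA1'.le hmax' he
      rw [hfr] at h
      have h2 := (u₁.comp A).le_opNorm e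
      rw [hA1', he, one_mul] at h2
      have e1 : ‖(√(n : ℝ) • (u₁.comp A : EuclideanSpace ℝ (Fin n) →ₗ[ℝ] X)) e‖ =
          √(n : ℝ) * ‖(u₁.comp A) e‖ := by
        rw [LinearMap.smul_apply, norm_smul, Real.norm_of_nonneg hsq.le]
        rfl
      rw [e1]
      refine ⟨?_, mul_le_of_le_one_right hsq.le h2⟩
      refine (one_le_sq_iff₀ (by positivity)).1 ?_
      rwa [mul_pow, Real.sq_sqrt (Nat.cast_nonneg n)])
  exact ⟨_, fun y => V.smul_mem _ (u₀ (A y)).2, fun y => by simpa using (hbd y).1,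
    fun y => (hbd y).2⟩

/-! ### Pointwise second-order estimates -/

section Perturbation

/-- Bound the power by `exp(qsx)` and use `|e^z - 1 - z| ≤ z²` for `|z| ≤ 1`. The error does not
depend on `x`, so it can be integrated, and `s` may have either sign. -/
theorem one_add_mul_rpow_le {x s q : ℝ} (hx0 : 0 ≤ x) (hx1 : x ≤ 1) (hq : 0 ≤ q) (hs : |s| < 1)
    (hqs : q * |s| ≤ 1) : (1 + s * x) ^ q ≤ 1 + q * s * x + q ^ 2 * s ^ 2 := by
  have hsx : |s * x| ≤ |s| := by
    rw [abs_mul, abs_of_nonneg hx0]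
    exact mul_le_of_le_one_right (abs_nonneg _) hx1
  have hpos : 0 < 1 + s * x := by
    have := neg_abs_le (s * x)
    linarith
  have habs : |q * (s * x)| ≤ q * |s| := by
    rw [abs_mul, abs_of_nonneg hq]
    exact mul_le_mul_of_nonneg_left hsx hq
  have h1 : (1 + s * x) ^ q ≤ Real.exp (q * (s * x)) := by
    rw [mul_comm q, Real.exp_mul]
    refine Real.rpow_le_rpow hpos.le ?_ hq
    rw [add_comm]
    exact Real.add_one_le_exp _
  have h2 := (abs_le.1 (Real.abs_exp_sub_one_sub_id_le (habs.trans hqs))).2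
  have h3 : (q * (s * x)) ^ 2 ≤ q ^ 2 * s ^ 2 := by
    rw [← sq_abs, ← sq_abs s, ← mul_pow]
    exact pow_le_pow_left₀ (abs_nonneg _) habs 2
  linarith

theorem rpow_sub_two_mul_sq_le {p F f : ℝ} (hF : 0 ≤ F) (hf : |f| ≤ F) :
    F ^ (p - 2) * f ^ 2 ≤ F ^ p := by
  rcases hF.eq_or_lt with rfl | hF'
  · have h0 : f = 0 := abs_nonpos_iff.1 hf
    rw [h0]
    have := Real.rpow_nonneg le_rfl (x := (0 : ℝ)) p
    simpa using this
  · have h1 : f ^ 2 ≤ F ^ 2 := by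
      rw [← sq_abs]
      exact pow_le_pow_left₀ (abs_nonneg _) hf 2
    calc F ^ (p - 2) * f ^ 2 ≤ F ^ (p - 2) * F ^ 2 :=
          mul_le_mul_of_nonneg_left h1 (Real.rpow_nonneg hF _)
      _ = F ^ p := by
          rw [← Real.rpow_natCast F 2, ← Real.rpow_add hF']
          norm_num

theorem sq_add_mul_sq_rpow_le {F f s p : ℝ} (hp : 0 < p) (hF : 0 ≤ F) (hf : |f| ≤ F)
    (hs : |s| < 1) (hqs : p / 2 * |s| ≤ 1) :
    (F ^ 2 + s * f ^ 2) ^ (p / 2) ≤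
      F ^ p + p / 2 * s * (F ^ (p - 2) * f ^ 2) + (p / 2) ^ 2 * s ^ 2 * F ^ p := by
  rcases hF.eq_or_lt with rfl | hF'
  · have h0 : f = 0 := abs_nonpos_iff.1 hf
    rw [h0]
    have h1 : (p / 2) ≠ 0 := by positivity
    simp [Real.zero_rpow h1, Real.zero_rpow hp.ne']
  · have h1 : f ^ 2 ≤ F ^ 2 := by
      rw [← sq_abs]
      exact pow_le_pow_left₀ (abs_nonneg _) hf 2
    have hx := one_add_mul_rpow_le (x := f ^ 2 / F ^ 2) (s := s) (q := p / 2) (by positivity)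
      ((div_le_one (by positivity)).2 h1) (by positivity) hs hqs
    have e1 : F ^ 2 + s * f ^ 2 = F ^ 2 * (1 + s * (f ^ 2 / F ^ 2)) := by
      field_simp
    have e2 : (F ^ 2 : ℝ) ^ (p / 2) = F ^ p := by
      rw [← Real.rpow_natCast F 2, ← Real.rpow_mul hF]
      congr 1
      push_cast
      ring
    have e3 : F ^ (p - 2) = F ^ p / F ^ 2 := by
      rw [Real.rpow_sub hF', Real.rpow_ofNat]
    have hnn : 0 ≤ 1 + s * (f ^ 2 / F ^ 2) := by
      have h2 : |s * (f ^ 2 / F ^ 2)| ≤ 1 := by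
        rw [abs_mul, abs_of_nonneg (show 0 ≤ f ^ 2 / F ^ 2 by positivity)]
        exact mul_le_one₀ hs.le (by positivity) ((div_le_one (by positivity)).2 h1)
      linarith [neg_abs_le (s * (f ^ 2 / F ^ 2))]
    rw [e1, Real.mul_rpow (by positivity) hnn, e2, e3]
    calc F ^ p * (1 + s * (f ^ 2 / F ^ 2)) ^ (p / 2)
        ≤ F ^ p * (1 + p / 2 * s * (f ^ 2 / F ^ 2) + (p / 2) ^ 2 * s ^ 2) :=
          mul_le_mul_of_nonneg_left hx (by positivity)
      _ = _ := by ring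

end Perturbation

/-! ### First-order condition and bounds on `∫ |f|^p` -/

section Integrals

open MeasureTheory

variable {Ω : Type*} [MeasurableSpace Ω] {μ : Measure Ω} {F f : Ω → ℝ} {p : ℝ}

theorem integrable_rpow_sub_two_mul_sq (hF : AEStronglyMeasurable F μ)
    (hf : AEStronglyMeasurable f μ) (hle : ∀ x, |f x| ≤ F x)
    (hFint : Integrable (fun x => F x ^ p) μ) :
    Integrable (fun x => F x ^ (p - 2) * f x ^ 2) μ := by
  refine hFint.mono' ?_ (Filter.Eventually.of_forall fun x => ?_)
  · exact ((hF.aemeasurable.pow_const _).mul (hf.aemeasurable.pow_const 2)).aestronglyMeasurable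
  · have h0 : 0 ≤ F x := (abs_nonneg _).trans (hle x)
    rw [Real.norm_of_nonneg (by positivity)]
    exact rpow_sub_two_mul_sq_le h0 (hle x)

/-- The first-order condition satisfied at a maximum of the determinant. -/
theorem mul_integral_rpow_sub_two_mul_sq_eq_one (hp : 0 < p) (hF : AEStronglyMeasurable F μ)
    (hf : AEStronglyMeasurable f μ) (hle : ∀ x, |f x| ≤ F x)
    (hFint : Integrable (fun x => F x ^ p) μ) (hone : ∫ x, F x ^ p ∂μ = 1) {n : ℕ} (hn : 1 ≤ n)
    (hdet : ∀ s : ℝ, -1 < s → ∃ r : ℝ, 0 ≤ r ∧ 1 + s ≤ r ^ (2 * n) ∧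
      r ^ p = ∫ x, (F x ^ 2 + s * f x ^ 2) ^ (p / 2) ∂μ) :
    n * ∫ x, F x ^ (p - 2) * f x ^ 2 ∂μ = 1 := by
  set G := ∫ x, F x ^ (p - 2) * f x ^ 2 ∂μ with hG
  have hF0 : ∀ x, 0 ≤ F x := fun x => (abs_nonneg _).trans (hle x)
  have hGint := integrable_rpow_sub_two_mul_sq hF hf hle hFint
  -- Chain `1 - 1/(1+s) ≤ log(1+s) ≤ 2n log r` with `p log r ≤ r^p - 1`, the latter expanded to
  -- second order in `s`.
  have key : ∀ s : ℝ, |s| < 1 → p / 2 * |s| ≤ 1 →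
      s / (1 + s) ≤ s * (n * G + n * (p / 2) * s) := by
    intro s hs hqs
    have hs1 : 0 < 1 + s := by linarith [neg_abs_le s]
    obtain ⟨r, hr0, hr1, hr2⟩ := hdet s (by linarith)
    have hsum : Integrable (fun x => F x ^ p + p / 2 * s * (F x ^ (p - 2) * f x ^ 2)) μ :=
      hFint.add (hGint.const_mul _)
    have hI : r ^ p ≤ 1 + p / 2 * s * G + (p / 2) ^ 2 * s ^ 2 := by
      have e : 1 + p / 2 * s * G + (p / 2) ^ 2 * s ^ 2 = ∫ x, (F x ^ p +
          p / 2 * s * (F x ^ (p - 2) * f x ^ 2) + (p / 2) ^ 2 * s ^ 2 * F x ^ p) ∂μ := by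
        rw [integral_add hsum (hFint.const_mul _),
          integral_add hFint (hGint.const_mul _), integral_const_mul, integral_const_mul, hone,
          mul_one]
      rw [hr2, e]
      refine integral_mono_of_nonneg (Filter.Eventually.of_forall fun x => ?_)
        (hsum.add (hFint.const_mul _))
        (Filter.Eventually.of_forall fun x => sq_add_mul_sq_rpow_le hp (hF0 x) (hle x) hs hqs)
      refine Real.rpow_nonneg ?_ _
      have h1 : f x ^ 2 ≤ F x ^ 2 := by
        rw [← sq_abs]
        exact pow_le_pow_left₀ (abs_nonneg _) (hle x) 2
      nlinarith [neg_abs_le s, sq_nonneg (f x)]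
    have hrpos : 0 < r := by
      refine lt_of_le_of_ne hr0 fun h => ?_
      rw [← h, zero_pow (by omega)] at hr1
      linarith
    have h1 : Real.log (1 + s) ≤ 2 * n * Real.log r := by
      have := Real.log_le_log hs1 hr1
      rw [Real.log_pow] at this
      exact_mod_cast this
    have h2 : p * Real.log r ≤ p / 2 * s * G + (p / 2) ^ 2 * s ^ 2 := by
      rw [← Real.log_rpow hrpos]
      have := Real.log_le_sub_one_of_pos (Real.rpow_pos_of_pos hrpos p)
      linarith
    have h3 : Real.log r ≤ s * G / 2 + p / 4 * s ^ 2 := by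
      refine le_of_mul_le_mul_left (h2.trans_eq ?_) hp
      ring
    have h4 := Real.one_sub_inv_le_log_of_pos hs1
    have h5 : 1 - (1 + s)⁻¹ = s / (1 + s) := by
      field_simp
      ring
    have h6 : 2 * n * Real.log r ≤ 2 * n * (s * G / 2 + p / 4 * s ^ 2) :=
      mul_le_mul_of_nonneg_left h3 (by positivity)
    rw [← h5]
    calc 1 - (1 + s)⁻¹ ≤ 2 * n * (s * G / 2 + p / 4 * s ^ 2) := h4.trans (h1.trans h6)
      _ = _ := by ring
  have hl1 : ContinuousAt (fun s : ℝ => 1 / (1 + s)) 0 := by fun_prop (disch := norm_num)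
  have hl2 : ContinuousAt (fun s : ℝ => n * G + n * (p / 2) * s) 0 := by fun_prop
  have hsmall : ∀ᶠ s : ℝ in nhds 0, |s| < 1 ∧ p / 2 * |s| ≤ 1 := by
    have c1 : ContinuousAt (fun s : ℝ => |s|) 0 := by fun_prop
    have c2 : ContinuousAt (fun s : ℝ => p / 2 * |s|) 0 := by fun_prop
    exact (c1.eventually_lt_const (by simp)).and
      ((c2.eventually_lt_const (by simp : p / 2 * |(0 : ℝ)| < 1)).mono fun _ h => h.le)
  -- Dividing by `s` reverses the inequality when `s < 0`; the two one-sided limits at `0` thus give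
  -- both bounds on `n G`.
  refine le_antisymm ?_ ?_
  · have h := le_of_tendsto_of_tendsto (hl2.tendsto.mono_left nhdsWithin_le_nhds)
      (hl1.tendsto.mono_left nhdsWithin_le_nhds) (b := nhdsWithin 0 (Set.Iio 0)) (by
        filter_upwards [self_mem_nhdsWithin, nhdsWithin_le_nhds hsmall] with s hs hs2
        have := key s hs2.1 hs2.2
        rw [div_eq_mul_one_div] at this
        exact (mul_le_mul_left_of_neg hs).1 this)
    simpa using h
  · have h := le_of_tendsto_of_tendsto (hl1.tendsto.mono_left nhdsWithin_le_nhds)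
      (hl2.tendsto.mono_left nhdsWithin_le_nhds) (b := nhdsWithin 0 (Set.Ioi 0)) (by
        filter_upwards [self_mem_nhdsWithin, nhdsWithin_le_nhds hsmall] with s hs hs2
        have := key s hs2.1 hs2.2
        rw [div_eq_mul_one_div] at this
        exact le_of_mul_le_mul_left this hs)
    simpa using h

theorem integrable_abs_rpow (hp : 0 < p) (hf : AEStronglyMeasurable f μ)
    (hle : ∀ x, |f x| ≤ F x) (hFint : Integrable (fun x => F x ^ p) μ) :
    Integrable (fun x => |f x| ^ p) μ := by
  refine hFint.mono' ?_ (Filter.Eventually.of_forall fun x => ?_)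
  · exact (hf.aemeasurable.abs.pow_const _).aestronglyMeasurable
  · rw [Real.norm_of_nonneg (by positivity)]
    exact Real.rpow_le_rpow (abs_nonneg _) (hle x) hp.le

/-- If `|f| ≤ F`, `∫ F ^ p = 1` and `n ∫ F ^ (p - 2) f ^ 2 = 1`, then `∫ |f| ^ p` lies between
`1 / n` and `n ^ (-p / 2)`: the case `2 ≤ p`. -/
theorem integral_abs_rpow_bounds_of_two_le (hp : 2 ≤ p) (hF : AEStronglyMeasurable F μ)
    (hf : AEStronglyMeasurable f μ) (hle : ∀ x, |f x| ≤ F x)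
    (hFint : Integrable (fun x => F x ^ p) μ) (hone : ∫ x, F x ^ p ∂μ = 1) {n : ℕ} (hn : 1 ≤ n)
    (hG : n * ∫ x, F x ^ (p - 2) * f x ^ 2 ∂μ = 1) :
    1 ≤ (n : ℝ) ^ (p / 2) * ∫ x, |f x| ^ p ∂μ ∧ n * ∫ x, |f x| ^ p ∂μ ≤ 1 := by
  have hp0 : 0 < p := by linarith
  have hF0 : ∀ x, 0 ≤ F x := fun x => (abs_nonneg _).trans (hle x)
  have hGint := integrable_rpow_sub_two_mul_sq hF hf hle hFint
  have hfint := integrable_abs_rpow hp0 hf hle hFint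
  constructor
  · have hpt : ∀ x, n * (F x ^ (p - 2) * f x ^ 2) ≤
        (1 - 2 / p) * F x ^ p + 2 / p * ((n : ℝ) ^ (p / 2) * |f x| ^ p) := by
      intro x
      have h := Real.geom_mean_le_arith_mean2_weighted (w₁ := 1 - 2 / p) (w₂ := 2 / p)
        (p₁ := F x ^ p) (p₂ := (n : ℝ) ^ (p / 2) * |f x| ^ p)
        (sub_nonneg.2 ((div_le_one hp0).2 hp)) (by positivity)
        (Real.rpow_nonneg (hF0 x) _) (by positivity) (by ring)
      refine le_of_eq_of_le ?_ h
      rw [Real.mul_rpow (by positivity) (by positivity), ← Real.rpow_mul (hF0 x),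
        ← Real.rpow_mul (Nat.cast_nonneg n), ← Real.rpow_mul (abs_nonneg _)]
      have e1 : p * (1 - 2 / p) = p - 2 := by field_simp
      have e2 : p / 2 * (2 / p) = 1 := by field_simp
      have e3 : p * (2 / p) = 2 := by field_simp
      rw [e1, e2, e3, Real.rpow_one, Real.rpow_ofNat, sq_abs]
      ring
    have h := integral_mono (hGint.const_mul n)
      ((hFint.const_mul (1 - 2 / p)).add ((hfint.const_mul ((n : ℝ) ^ (p / 2))).const_mul (2 / p)))
      hpt
    simp only [Pi.add_apply] at h
    rw [integral_add (hFint.const_mul _) ((hfint.const_mul _).const_mul _), integral_const_mul,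
      integral_const_mul, integral_const_mul, integral_const_mul, hG, hone] at h
    have h2 : 2 / p * 1 ≤ 2 / p * ((n : ℝ) ^ (p / 2) * ∫ x, |f x| ^ p ∂μ) := by linarith
    exact le_of_mul_le_mul_left h2 (by positivity)
  · rw [← hG]
    refine mul_le_mul_of_nonneg_left (integral_mono hfint hGint fun x => ?_) (Nat.cast_nonneg n)
    change |f x| ^ p ≤ F x ^ (p - 2) * f x ^ 2
    have e : |f x| ^ p = |f x| ^ (p - 2) * f x ^ 2 := by
      rcases (abs_nonneg (f x)).eq_or_lt with h0 | h0
      · rw [← h0, abs_eq_zero.1 h0.symm, Real.zero_rpow hp0.ne']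
        simp
      · rw [← sq_abs (f x), ← Real.rpow_natCast |f x| 2, ← Real.rpow_add h0]
        norm_num
    rw [e]
    exact mul_le_mul_of_nonneg_right
      (Real.rpow_le_rpow (abs_nonneg _) (hle x) (by linarith)) (sq_nonneg _)

/-- The counterpart of `integral_abs_rpow_bounds_of_two_le` for `p ≤ 2`. -/
theorem integral_abs_rpow_bounds_of_le_two (hp0 : 0 < p) (hp : p ≤ 2)
    (hF : AEStronglyMeasurable F μ) (hf : AEStronglyMeasurable f μ) (hle : ∀ x, |f x| ≤ F x)
    (hFint : Integrable (fun x => F x ^ p) μ) (hone : ∫ x, F x ^ p ∂μ = 1) {n : ℕ}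
    (hG : n * ∫ x, F x ^ (p - 2) * f x ^ 2 ∂μ = 1) :
    1 ≤ n * ∫ x, |f x| ^ p ∂μ ∧ (n : ℝ) ^ (p / 2) * ∫ x, |f x| ^ p ∂μ ≤ 1 := by
  have hF0 : ∀ x, 0 ≤ F x := fun x => (abs_nonneg _).trans (hle x)
  have hGint := integrable_rpow_sub_two_mul_sq hF hf hle hFint
  have hfint := integrable_abs_rpow hp0 hf hle hFint
  constructor
  · rw [← hG]
    refine mul_le_mul_of_nonneg_left (integral_mono hGint hfint fun x => ?_) (Nat.cast_nonneg n)
    change F x ^ (p - 2) * f x ^ 2 ≤ |f x| ^ p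
    rcases (abs_nonneg (f x)).eq_or_lt with h0 | h0
    · rw [← h0, abs_eq_zero.1 h0.symm, Real.zero_rpow hp0.ne']
      simp
    · have e : |f x| ^ p = |f x| ^ (p - 2) * f x ^ 2 := by
        rw [← sq_abs (f x), ← Real.rpow_natCast |f x| 2, ← Real.rpow_add h0]
        norm_num
      rw [e]
      exact mul_le_mul_of_nonneg_right
        (Real.rpow_le_rpow_of_nonpos h0 (hle x) (by linarith)) (sq_nonneg _)
  -- AM-GM with weights `p/2` and `1 - p/2`; the powers of `F` cancel in the geometric mean.
  · have hpt : ∀ x, (n : ℝ) ^ (p / 2) * |f x| ^ p ≤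
        p / 2 * (n * (F x ^ (p - 2) * f x ^ 2)) + (1 - p / 2) * F x ^ p := by
      intro x
      have hGx : 0 ≤ F x ^ (p - 2) * f x ^ 2 :=
        mul_nonneg (Real.rpow_nonneg (hF0 x) _) (sq_nonneg _)
      have h := Real.geom_mean_le_arith_mean2_weighted (w₁ := p / 2) (w₂ := 1 - p / 2)
        (p₁ := n * (F x ^ (p - 2) * f x ^ 2)) (p₂ := F x ^ p)
        (by positivity) (by linarith) (mul_nonneg (Nat.cast_nonneg n) hGx)
        (Real.rpow_nonneg (hF0 x) _) (by ring)
      refine le_of_eq_of_le ?_ h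
      rw [Real.mul_rpow (Nat.cast_nonneg n) hGx,
        Real.mul_rpow (Real.rpow_nonneg (hF0 x) _) (sq_nonneg _), ← Real.rpow_mul (hF0 x),
        ← Real.rpow_mul (hF0 x), ← sq_abs (f x), ← Real.rpow_natCast |f x| 2,
        ← Real.rpow_mul (abs_nonneg _)]
      have e1 : ((2 : ℕ) : ℝ) * (p / 2) = p := by push_cast; ring
      rw [e1]
      rcases (hF0 x).eq_or_lt with h0 | h0
      · have hf0 : |f x| = 0 := le_antisymm ((hle x).trans h0.symm.le) (abs_nonneg _)
        rw [hf0, Real.zero_rpow hp0.ne']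
        simp
      · have e2 : F x ^ ((p - 2) * (p / 2)) * F x ^ (p * (1 - p / 2)) = 1 := by
          rw [← Real.rpow_add h0, show (p - 2) * (p / 2) + p * (1 - p / 2) = 0 by ring,
            Real.rpow_zero]
        calc (n : ℝ) ^ (p / 2) * |f x| ^ p = (n : ℝ) ^ (p / 2) * |f x| ^ p *
              (F x ^ ((p - 2) * (p / 2)) * F x ^ (p * (1 - p / 2))) := by rw [e2, mul_one]
          _ = _ := by ring
    have h := integral_mono (hfint.const_mul ((n : ℝ) ^ (p / 2)))
      (((hGint.const_mul n).const_mul (p / 2)).add (hFint.const_mul (1 - p / 2))) hpt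
    simp only [Pi.add_apply] at h
    rw [integral_add ((hGint.const_mul _).const_mul _) (hFint.const_mul _), integral_const_mul,
      integral_const_mul, integral_const_mul, integral_const_mul, hG, hone] at h
    linarith

end Integrals

/-! ### Lewis's theorem for subspaces of `L_p` -/

section Lewis

open MeasureTheory
open scoped RealInnerProductSpace

variable {Ω : Type*} [MeasurableSpace Ω] {μ : Measure Ω} {p : ℝ≥0∞}

theorem ContinuousLinearMap.compLp_comp {E F G : Type*} [NormedAddCommGroup E] [NormedSpace ℝ E]
    [NormedAddCommGroup F] [NormedSpace ℝ F] [NormedAddCommGroup G] [NormedSpace ℝ G]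
    (A : F →L[ℝ] G) (B : E →L[ℝ] F) (f : Lp E p μ) :
    A.compLp (B.compLp f) = (A.comp B).compLp f := by
  ext1
  filter_upwards [A.coeFn_compLp (B.compLp f), B.coeFn_compLp f, (A.comp B).coeFn_compLp f]
    with x h1 h2 h3
  rw [h1, h2, h3]
  rfl

theorem MeasureTheory.Lp.norm_rpow_eq_integral {E : Type*} [NormedAddCommGroup E] (h0 : p ≠ 0)
    (h1 : p ≠ ∞) (f : Lp E p μ) : ‖f‖ ^ p.toReal = ∫ x, ‖f x‖ ^ p.toReal ∂μ := by
  have hp : 0 < p.toReal := ENNReal.toReal_pos h0 h1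
  have hI : 0 ≤ ∫ x, ‖f x‖ ^ p.toReal ∂μ := integral_nonneg fun x => by positivity
  rw [Lp.norm_def, (Lp.memLp f).eLpNorm_eq_integral_rpow_norm h0 h1,
    ENNReal.toReal_ofReal (Real.rpow_nonneg hI _), Real.rpow_inv_rpow hI hp.ne']

/-- Every linear map from a finite-dimensional inner product space to `L_p` is of the form
`θ ↦ ⟪θ, Ψ ·⟫` with `Ψ` a vector-valued function in `L_p`. -/
theorem exists_innerSL_compLp_eq [Fact (1 ≤ p)] {n : ℕ}
    (u : EuclideanSpace ℝ (Fin n) →ₗ[ℝ] Lp ℝ p μ) :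
    ∃ Ψ : Lp (EuclideanSpace ℝ (Fin n)) p μ, ∀ θ, (innerSL ℝ θ).compLp Ψ = u θ := by
  refine ⟨∑ i, (ContinuousLinearMap.toSpanSingleton ℝ (EuclideanSpace.single i (1 : ℝ))).compLp
    (u (EuclideanSpace.single i 1)), fun θ => ?_⟩
  have h := map_sum ((innerSL ℝ θ).compLpₗ p μ) (fun i =>
    (ContinuousLinearMap.toSpanSingleton ℝ (EuclideanSpace.single i (1 : ℝ))).compLp
    (u (EuclideanSpace.single i 1))) Finset.univ
  simp only [ContinuousLinearMap.compLpₗ_apply, ContinuousLinearMap.compLp_comp] at h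
  rw [h]
  have hθ : θ = ∑ i, θ i • EuclideanSpace.single i (1 : ℝ) := by
    ext j
    simp [Finset.sum_apply, Pi.single_apply]
  conv_rhs => rw [hθ, map_sum]
  refine Finset.sum_congr rfl fun i _ => ?_
  rw [map_smul]
  ext1
  filter_upwards [ContinuousLinearMap.coeFn_compLp ((innerSL ℝ θ).comp
    (ContinuousLinearMap.toSpanSingleton ℝ (EuclideanSpace.single i (1 : ℝ))))
    (u (EuclideanSpace.single i 1)), Lp.coeFn_smul (θ i) (u (EuclideanSpace.single i 1))]
    with x h1 h2
  rw [h1, h2]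
  simp [mul_comm, EuclideanSpace.inner_single_right]

/-- **Lewis's theorem**, in terms of a vector-valued function: coordinates of an `n`-dimensional
subspace of `L_p` in which the `L_p`-norm of a unit vector is controlled. -/
theorem exists_lewis_coordinates [Fact (1 ≤ p)] (hp : p ≠ ∞) {n : ℕ} (hn : 1 ≤ n)
    (V : Submodule ℝ (Lp ℝ p μ)) (hV : Module.rank ℝ V = n) :
    ∃ T : EuclideanSpace ℝ (Fin n) →ₗ[ℝ] Lp ℝ p μ, (∀ y, T y ∈ V) ∧ ∀ e, ‖e‖ = 1 →
      (2 ≤ p.toReal → 1 ≤ (n : ℝ) ^ (p.toReal / 2) * ‖T e‖ ^ p.toReal ∧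
        n * ‖T e‖ ^ p.toReal ≤ 1) ∧
      (p.toReal ≤ 2 → 1 ≤ n * ‖T e‖ ^ p.toReal ∧
        (n : ℝ) ^ (p.toReal / 2) * ‖T e‖ ^ p.toReal ≤ 1) := by
  have hp1 : 1 ≤ p := Fact.out
  have hp0 : p ≠ 0 := (zero_lt_one.trans_le hp1).ne'
  have hpr : 0 < p.toReal := ENNReal.toReal_pos hp0 hp
  have : FiniteDimensional ℝ V := Module.finite_of_rank_eq_nat hV
  have : Nonempty (Fin n) := ⟨⟨0, hn⟩⟩
  have hfr : Module.finrank ℝ (EuclideanSpace ℝ (Fin n)) = n := finrank_euclideanSpace_fin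
  let u₀ : EuclideanSpace ℝ (Fin n) ≃ₗ[ℝ] V :=
    LinearEquiv.ofFinrankEq _ _ (by rw [hfr, Module.finrank_eq_of_rank_eq hV])
  obtain ⟨Ψ, hΨ⟩ := exists_innerSL_compLp_eq (V.subtype ∘ₗ u₀.toLinearMap)
  let J : (EuclideanSpace ℝ (Fin n) →L[ℝ] EuclideanSpace ℝ (Fin n)) →ₗ[ℝ]
      Lp (EuclideanSpace ℝ (Fin n)) p μ :=
    { toFun := fun A => A.compLp Ψ
      map_add' := fun A B => A.add_compLp B Ψ
      map_smul' := fun r A => A.smul_compLp r Ψ }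
  -- Replacing `Ψ` by `A Ψ` amounts to precomposing the parametrisation `u₀` with the adjoint of
  -- `A`; hence the adjoint in the final `T`.
  have hinner : ∀ (A : EuclideanSpace ℝ (Fin n) →L[ℝ] EuclideanSpace ℝ (Fin n)) θ,
      (innerSL ℝ θ).compLp (A.compLp Ψ) = u₀ (A.adjoint θ) := by
    intro A θ
    have e : (innerSL ℝ θ).comp A = innerSL ℝ (A.adjoint θ) := by
      ext1 y
      simp [ContinuousLinearMap.adjoint_inner_left]
    rw [ContinuousLinearMap.compLp_comp, e, hΨ]
    rfl
  have hJ : Function.Injective J := by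
    intro A B hAB
    have hAB' : A.compLp Ψ = B.compLp Ψ := hAB
    refine ContinuousLinearMap.adjoint.injective ?_
    ext1 θ
    refine u₀.injective (Subtype.ext ?_)
    rw [← hinner, ← hinner, hAB']
  obtain ⟨A, hA, hA1, hmax⟩ := exists_norm_eq_one_abs_det_le J hJ
  set Φ := A.compLp Ψ with hΦ
  have hA1' : ‖Φ‖ = 1 := hA1
  have hmax' : ∀ B : EuclideanSpace ℝ (Fin n) →L[ℝ] EuclideanSpace ℝ (Fin n),
      |B.det| ≤ ‖B.compLp Φ‖ ^ n := by
    intro B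
    have h := hmax (B.comp A)
    rw [ContinuousLinearMap.det_comp_eq, abs_mul, mul_comm, hfr] at h
    have h' := le_of_mul_le_mul_left h (abs_pos.2 hA)
    rwa [hΦ, ContinuousLinearMap.compLp_comp]
  refine ⟨V.subtype ∘ₗ u₀.toLinearMap ∘ₗ (A.adjoint : _ →ₗ[ℝ] _), fun y => (u₀ _).2,
    fun e he => ?_⟩
  have hTe : (V.subtype ∘ₗ u₀.toLinearMap ∘ₗ (A.adjoint : _ →ₗ[ℝ] _)) e =
      (innerSL ℝ e).compLp Φ := (hinner A e).symm
  have hF : AEStronglyMeasurable (fun x => ‖Φ x‖) μ := (Lp.aestronglyMeasurable Φ).norm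
  have hf : AEStronglyMeasurable (fun x => ⟪e, Φ x⟫) μ :=
    (innerSL ℝ e).continuous.comp_aestronglyMeasurable (Lp.aestronglyMeasurable Φ)
  have hle : ∀ x, |⟪e, Φ x⟫| ≤ ‖Φ x‖ := fun x => by
    have := abs_real_inner_le_norm e (Φ x)
    rwa [he, one_mul] at this
  have hFint : Integrable (fun x => ‖Φ x‖ ^ p.toReal) μ := (Lp.memLp Φ).integrable_norm_rpow hp0 hp
  have hone : ∫ x, ‖Φ x‖ ^ p.toReal ∂μ = 1 := by
    rw [← Lp.norm_rpow_eq_integral hp0 hp, hA1', Real.one_rpow]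
  have hnorm : ‖(innerSL ℝ e).compLp Φ‖ ^ p.toReal = ∫ x, |⟪e, Φ x⟫| ^ p.toReal ∂μ := by
    rw [Lp.norm_rpow_eq_integral hp0 hp]
    refine integral_congr_ae ?_
    filter_upwards [(innerSL ℝ e).coeFn_compLp Φ] with x hx
    rw [hx, Real.norm_eq_abs, innerSL_apply_apply]
  -- The witness `r` is the `L_p` norm of the stretched `Φ`, whose pointwise squared norm is `F² + s
  -- f²`.
  have hG := mul_integral_rpow_sub_two_mul_sq_eq_one hpr hF hf hle hFint hone hn fun s hs => by
    have hs0 : 0 ≤ 1 + s := by linarith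
    set t := √(1 + s) - 1 with ht
    have ht2 : (1 + t) ^ 2 = 1 + s := by rw [ht, add_sub_cancel, Real.sq_sqrt hs0]
    refine ⟨‖(stretch e t).compLp Φ‖, norm_nonneg _, ?_, ?_⟩
    · have h := pow_le_pow_left₀ (abs_nonneg _) (hmax' (stretch e t)) 2
      rwa [sq_abs, det_stretch he, ht2, ← pow_mul, mul_comm n] at h
    · rw [Lp.norm_rpow_eq_integral hp0 hp]
      refine integral_congr_ae ?_
      filter_upwards [(stretch e t).coeFn_compLp Φ] with x hx
      rw [hx, show s = (1 + t) ^ 2 - 1 by rw [ht2]; ring, ← norm_stretch_sq he,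
        ← Real.rpow_natCast, ← Real.rpow_mul (norm_nonneg _)]
      congr 1
      push_cast
      ring
  rw [hTe, hnorm]
  exact ⟨fun h => integral_abs_rpow_bounds_of_two_le h hF hf hle hFint hone hn hG,
    fun h => integral_abs_rpow_bounds_of_le_two hpr h hF hf hle hFint hone hG⟩

theorem rpow_neg_le_of_one_le_rpow_mul {a c r q : ℝ} (ha : 0 < a) (hr : 0 ≤ r) (hq : 0 < q)
    (h : 1 ≤ a ^ (q * c) * r ^ q) : a ^ (-c) ≤ r := by
  rw [← Real.rpow_le_rpow_iff (by positivity) hr hq, ← Real.rpow_mul ha.le,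
    show -c * q = -(q * c) by ring, Real.rpow_neg ha.le, inv_le_iff_one_le_mul₀ (by positivity),
    mul_comm]
  exact h

theorem le_rpow_neg_of_rpow_mul_le_one {a c r q : ℝ} (ha : 0 < a) (hr : 0 ≤ r) (hq : 0 < q)
    (h : a ^ (q * c) * r ^ q ≤ 1) : r ≤ a ^ (-c) := by
  rw [← Real.rpow_le_rpow_iff hr (by positivity) hq, ← Real.rpow_mul ha.le,
    show -c * q = -(q * c) by ring, Real.rpow_neg ha.le, ← one_div,
    le_div_iff₀ (by positivity), mul_comm]
  exact h

/-- **Lewis's theorem**: an `n`-dimensional subspace of `L_p` has Banach-Mazur distance at most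
`n ^ |1 / 2 - 1 / p|` from the Euclidean space. -/
theorem exists_euclidean_distortion_le_rpow [Fact (1 ≤ p)] {n : ℕ} (hn : 1 ≤ n)
    (V : Submodule ℝ (Lp ℝ p μ)) (hV : Module.rank ℝ V = n) :
    ∃ T : EuclideanSpace ℝ (Fin n) →ₗ[ℝ] Lp ℝ p μ, (∀ y, T y ∈ V) ∧ (∀ y, ‖y‖ ≤ ‖T y‖) ∧
      ∀ y, ‖T y‖ ≤ (n : ℝ) ^ |1 / 2 - (p⁻¹).toReal| * ‖y‖ := by
  by_cases hp : p = ∞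
  · subst hp
    have e : (n : ℝ) ^ |1 / 2 - ((∞ : ℝ≥0∞)⁻¹).toReal| = √(n : ℝ) := by
      rw [ENNReal.inv_top, ENNReal.toReal_zero, sub_zero, abs_of_pos one_half_pos,
        Real.sqrt_eq_rpow]
    rw [e]
    exact exists_euclidean_distortion_le_sqrt hn V hV
  have hp1 : 1 ≤ p := Fact.out
  have hp0 : p ≠ 0 := (zero_lt_one.trans_le hp1).ne'
  have hq : 0 < p.toReal := ENNReal.toReal_pos hp0 hp
  obtain ⟨T, hTV, hT⟩ := exists_lewis_coordinates hp hn V hV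
  rw [ENNReal.toReal_inv]
  set q := p.toReal with hqdef
  have hn0 : (0 : ℝ) < n := by exact_mod_cast hn
  have hqinv : (n : ℝ) ^ (q * q⁻¹) = n := by rw [mul_inv_cancel₀ hq.ne', Real.rpow_one]
  -- On unit vectors `‖T e‖` lies between `n^(-α)` and `n^(-β)`; rescaling by `n^α` leaves
  -- distortion `n^(α-β)`. The values `1/2` and `1/q` swap roles at `q = 2`.
  obtain ⟨α, β, hαβ, hbd⟩ : ∃ α β : ℝ, α - β = |1 / 2 - q⁻¹| ∧
      ∀ e, ‖e‖ = 1 → (n : ℝ) ^ (-α) ≤ ‖T e‖ ∧ ‖T e‖ ≤ (n : ℝ) ^ (-β) := by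
    rcases le_total 2 q with h2 | h2
    · refine ⟨1 / 2, q⁻¹, ?_, fun e he => ?_⟩
      · rw [abs_of_nonneg]
        rw [sub_nonneg, one_div]
        exact inv_anti₀ two_pos h2
      · obtain ⟨h3, h4⟩ := (hT e he).1 h2
        rw [div_eq_mul_one_div] at h3
        refine ⟨rpow_neg_le_of_one_le_rpow_mul hn0 (norm_nonneg _) hq h3,
          le_rpow_neg_of_rpow_mul_le_one hn0 (norm_nonneg _) hq ?_⟩
        rwa [hqinv]
    · refine ⟨q⁻¹, 1 / 2, ?_, fun e he => ?_⟩
      · rw [abs_sub_comm, abs_of_nonneg]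
        rw [sub_nonneg, one_div]
        exact inv_anti₀ hq h2
      · obtain ⟨h3, h4⟩ := (hT e he).2 h2
        rw [div_eq_mul_one_div] at h4
        refine ⟨rpow_neg_le_of_one_le_rpow_mul hn0 (norm_nonneg _) hq ?_,
          le_rpow_neg_of_rpow_mul_le_one hn0 (norm_nonneg _) hq h4⟩
        rwa [hqinv]
  have hnα : 0 < (n : ℝ) ^ α := Real.rpow_pos_of_pos hn0 _
  have hinv : (n : ℝ) ^ α * (n : ℝ) ^ (-α) = 1 := by
    rw [← Real.rpow_add hn0, add_neg_cancel, Real.rpow_zero]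
  have h := le_norm_map_of_unit ((n : ℝ) ^ α • T) (a := 1) (b := (n : ℝ) ^ |1 / 2 - q⁻¹|)
    (fun e he => by
      rw [LinearMap.smul_apply, norm_smul, Real.norm_of_nonneg hnα.le]
      refine ⟨?_, ?_⟩
      · rw [← hinv]
        exact mul_le_mul_of_nonneg_left (hbd e he).1 hnα.le
      · rw [← hαβ, sub_eq_add_neg, Real.rpow_add hn0]
        exact mul_le_mul_of_nonneg_left (hbd e he).2 hnα.le)
  exact ⟨_, fun y => V.smul_mem _ (hTV y), fun y => by simpa using (h y).1, fun y => (h y).2⟩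

end Lewis

/-! ### The lemma: gluing with the constants of John and Lewis -/

theorem lemma3p4 (n : ℕ) (hn : 1 ≤ n) (N : ℝ) (hN : 1 < N) :
    (∀ (X : Type u) [NormedAddCommGroup X] [NormedSpace ℝ X] [CompleteSpace X] (K : Set X),
      IsCompact K → IsLUB ((fun f : X => ‖f‖) '' K) 1 →
        lipschitzWidth K (n + 1) (2 * (N + 1) * √(n : ℝ)) ≤ nonlinearKolmogorovWidth K n N ∧
        lipschitzWidth K (n + ⌈Real.logb 2 N⌉₊) (6 * √(n : ℝ)) ≤
          nonlinearKolmogorovWidth K n N) ∧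
    (∀ (Ω : Type v) [MeasurableSpace Ω] (μ : MeasureTheory.Measure Ω) (p : ℝ≥0∞) [Fact (1 ≤ p)]
      (K : Set (MeasureTheory.Lp ℝ p μ)),
      IsCompact K → IsLUB ((fun f : MeasureTheory.Lp ℝ p μ => ‖f‖) '' K) 1 →
        lipschitzWidth K (n + 1) (2 * (N + 1) * (n : ℝ) ^ |1 / 2 - (p⁻¹).toReal|) ≤
          nonlinearKolmogorovWidth K n N ∧
        lipschitzWidth K (n + ⌈Real.logb 2 N⌉₊) (6 * (n : ℝ) ^ |1 / 2 - (p⁻¹).toReal|) ≤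
          nonlinearKolmogorovWidth K n N) := by
  refine ⟨fun X _ _ _ K _ hK => ?_, fun Ω _ μ p _ K _ hK => ?_⟩
  · exact lipschitzWidth_le_nonlinearKolmogorovWidth (fun f hf => hK.1 ⟨f, hf, rfl⟩) hn hN
      (Real.sqrt_nonneg _) (exists_euclidean_distortion_le_sqrt hn)
  · exact lipschitzWidth_le_nonlinearKolmogorovWidth (fun f hf => hK.1 ⟨f, hf, rfl⟩) hn hN
      (Real.rpow_nonneg (Nat.cast_nonneg n) _) (exists_euclidean_distortion_le_rpow hn)
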